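/- For an integer $k\ge 1$ and real $c$ let $$\gamma_k(c)=\frac{1}{k!\,G(1+k)^2}\int_{[0,1]^k}\delta(t_1+\dots+t_k-c)\prod_{i<j}(t_i-t_j)^2\,dt_1\cdots dt_k,\qquad G(1+k)=1!\,2!\cdots(k-1)!,$$ where the delta function means that the integral is taken over $(t_1,\dots,t_{k-1})$ with $t_k=c-t_1-\dots-t_{k-1}$, over the region where $0\le t_i\le 1$ for all $1\le i\le k$. For an integer $j$ with $0<j<k$ put $\nu(j,k)=j^2+(k-j)^2$. Then $\gamma_k$ is $(\nu(j,k)-2)$-times differentiable at $c=j$; more precisely, it is $(\nu(j,k)-2)$-times continuously differentiable in a neighbourhood of $c=j$ (continuous there, if $\nu(j,k)=2$). Moreover, its $(\nu(j,k)-2)$-th derivative is not differentiable at $c=j$. -/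

import Mathlib

open scoped Nat

/-- The point `(x₁, …, xₙ, c - (x₁ + ⋯ + xₙ))` of the hyperplane `t₁ + ⋯ + tₙ₊₁ = c` in `ℝⁿ⁺¹`. -/
def slicePoint {n : ℕ} (c : ℝ) (x : Fin n → ℝ) : Fin (n + 1) → ℝ :=
  Fin.snoc x (c - ∑ i, x i)

/-- The squared Vandermonde product `∏_{i < j} (tᵢ - tⱼ)²`. -/
def vandermondeSq {k : ℕ} (t : Fin k → ℝ) : ℝ :=
  ∏ i, ∏ j ∈ Finset.Ioi i, (t i - t j) ^ 2

/-- The function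
`γ_k(c) = 1 / (k! G(1+k)²) ∫_{[0,1]^k} δ(t₁ + ⋯ + t_k - c) ∏_{i<j} (tᵢ - tⱼ)² dt₁ ⋯ dt_k`, `k ≥ 1`.

The delta function is integrated out in the last variable: the integral runs over
`(t₁, …, t_{k-1})`, with `t_k = c - (t₁ + ⋯ + t_{k-1})`, over the region where all of
`t₁, …, t_k` lie in `[0,1]`. With `k = n + 1`, the value `G(1+k) = 1! 2! ⋯ (k-1)!` of the Barnes
function is the superfactorial of `n`. For `k = 0` there is no such function; the value is `0`. -/
noncomputable def gammaFun : ℕ → ℝ → ℝ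
  | 0, _ => 0
  | n + 1, c =>
      1 / (((n + 1)! : ℝ) * (Nat.superFactorial n : ℝ) ^ 2) *
        ∫ x in {x : Fin n → ℝ | ∀ i, slicePoint c x i ∈ Set.Icc (0 : ℝ) 1},
          vandermondeSq (slicePoint c x)

/-- `ν(j,k) = j² + (k - j)²`, used for `j ≤ k` only. -/
def nu (j k : ℕ) : ℕ := j ^ 2 + (k - j) ^ 2

/-! On `[0,1]` the indicator is `1_{t ≥ 0} - 1_{t > 1}`, so expanding the product gives a signed sum
over subsets `S`, i.e. over vertices of the cube. Expanding the squared Vandermonde in monomials `w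
^ m` about each vertex and convolving truncated powers makes `γ_k` a finite sum of truncated powers
with knot `|S|` and exponent `deg m + k - 1` (`gammaFun_eq_sum_truncPow`).

At `c = j` only the sets with `|S| = j` are singular. There the lowest-degree form of the
Vandermonde has degree `ν(j,k) - k`, so the leading exponent is `ν(j,k) - 1`; such a truncated power
has a kink in its `(ν(j,k) - 2)`-th derivative. The leading terms do not cancel: all carry the sign
`(-1)^j`, and each weight `∑ coeff · ∏ mᵢ!` is the integral of a nonnegative form against `e^{-∑
w}`, hence positive (`sum_coeff_shiftedVandermondeSq_pos`). -/

open MeasureTheory Filter Topology Set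
open scoped ENNReal

/-! ### Truncated powers and their convolution -/

/-- The normalized truncated power `(t - e)₊ ^ q / q!`, vanishing at `t = e` also for `q = 0`. -/
noncomputable def truncPow (e : ℝ) (q : ℕ) (t : ℝ) : ℝ :=
  if e < t then (t - e) ^ q / q ! else 0

theorem truncPow_nonneg (e : ℝ) (q : ℕ) (t : ℝ) : 0 ≤ truncPow e q t := by
  unfold truncPow
  split_ifs with h
  · have := sub_pos.2 h
    positivity
  · exact le_rfl

theorem hasDerivAt_pow_div_factorial (e : ℝ) (q : ℕ) (t : ℝ) :
    HasDerivAt (fun y => (y - e) ^ (q + 1) / ((q + 1)! : ℝ)) ((t - e) ^ q / q !) t := by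
  have h := (((hasDerivAt_id t).sub_const e).pow (q + 1)).div_const ((q + 1)! : ℝ)
  refine h.congr_deriv ?_
  have : (q ! : ℝ) ≠ 0 := by positivity
  simp only [Nat.factorial_succ, id]
  push_cast
  field_simp

theorem hasDerivAt_neg_pow_div_factorial (d : ℝ) (q : ℕ) (t : ℝ) :
    HasDerivAt (fun y => -((d - y) ^ (q + 1) / ((q + 1)! : ℝ))) ((d - t) ^ q / q !) t := by
  have h := ((((hasDerivAt_id t).const_sub d).pow (q + 1)).div_const ((q + 1)! : ℝ)).neg
  refine h.congr_deriv ?_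
  have : (q ! : ℝ) ≠ 0 := by positivity
  simp only [Nat.factorial_succ, id]
  push_cast
  field_simp

/-- A Beta integral. Integration by parts trades a power of `y - e` for one of `d - y`, with
vanishing boundary terms; hence `b` is generalized. -/
theorem integral_pow_div_factorial_mul_pow_div_factorial (a b : ℕ) (e d : ℝ) :
    ∫ y in e..d, (y - e) ^ a / a ! * ((d - y) ^ b / b !) =
      (d - e) ^ (a + b + 1) / (a + b + 1)! := by
  induction a generalizing b with
  | zero =>
    have h := intervalIntegral.integral_eq_sub_of_hasDerivAt (a := e) (b := d)
      (fun y _ => hasDerivAt_neg_pow_div_factorial d b y)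
      (Continuous.intervalIntegrable (by fun_prop) _ _)
    simpa using h
  | succ a ih =>
    have h := intervalIntegral.integral_mul_deriv_eq_deriv_mul (a := e) (b := d)
      (fun y _ => hasDerivAt_pow_div_factorial e a y)
      (fun y _ => hasDerivAt_neg_pow_div_factorial d b y)
      (Continuous.intervalIntegrable (by fun_prop) _ _)
      (Continuous.intervalIntegrable (by fun_prop) _ _)
    rw [h]
    have h2 := ih (b + 1)
    simp only [mul_neg, intervalIntegral.integral_neg, h2]
    simp
    ring_nf

theorem lintegral_truncPow_mul_truncPow (e d : ℝ) (a b : ℕ) (c : ℝ) :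
    ∫⁻ y, ENNReal.ofReal (truncPow e a y) * ENNReal.ofReal (truncPow d b (c - y)) =
      ENNReal.ofReal (truncPow (e + d) (a + b + 1) c) := by
  have hind : (fun y => ENNReal.ofReal (truncPow e a y) * ENNReal.ofReal (truncPow d b (c - y))) =
      (Ioo e (c - d)).indicator
        (fun y => ENNReal.ofReal ((y - e) ^ a / a ! * ((c - d - y) ^ b / b !))) := by
    funext y
    unfold truncPow
    by_cases h1 : e < y
    · by_cases h2 : d < c - y
      · have h3 := sub_pos.2 h1
        rw [indicator_of_mem (show y ∈ Ioo e (c - d) from ⟨h1, by linarith⟩), if_pos h1, if_pos h2,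
          ← ENNReal.ofReal_mul (by positivity), sub_right_comm]
      · rw [indicator_of_notMem (fun h => h2 (by linarith [h.2])), if_neg h2]
        simp
    · rw [indicator_of_notMem (fun h => h1 h.1), if_neg h1]
      simp
  rw [hind, lintegral_indicator measurableSet_Ioo]
  rcases le_or_gt c (e + d) with hc | hc
  · rw [Ioo_eq_empty (by linarith), truncPow, if_neg (by linarith)]
    simp
  · have hle : e ≤ c - d := by linarith
    rw [← ofReal_integral_eq_lintegral_ofReal, ← integral_Ioc_eq_integral_Ioo,
      ← intervalIntegral.integral_of_le hle, integral_pow_div_factorial_mul_pow_div_factorial,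
      truncPow, if_pos hc]
    · congr 3
      ring
    · exact (Continuous.integrableOn_Icc (by fun_prop)).mono_set Ioo_subset_Icc_self
    · filter_upwards [ae_restrict_mem measurableSet_Ioo] with y hy
      have h1 := sub_pos.2 hy.1
      have h2 := sub_pos.2 hy.2
      simp only [Pi.zero_apply]
      positivity

/-! ### Slice integrals of product functions -/

theorem slicePoint_cons {n : ℕ} (c y : ℝ) (x : Fin n → ℝ) :
    slicePoint c (Fin.cons y x : Fin (n + 1) → ℝ) = Fin.cons y (slicePoint (c - y) x) := by
  unfold slicePoint
  rw [Fin.cons_snoc_eq_snoc_cons]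
  congr 1
  simp [Fin.sum_univ_succ]
  ring

theorem measurable_slicePoint {n : ℕ} :
    Measurable (fun p : ℝ × (Fin n → ℝ) => slicePoint p.1 p.2) := by
  refine measurable_pi_lambda _ fun i => ?_
  refine Fin.lastCases ?_ (fun i => ?_) i
  · simp only [slicePoint, Fin.snoc_last]
    fun_prop
  · simp only [slicePoint, Fin.snoc_castSucc]
    fun_prop

/-- An iterated convolution, peeling off one coordinate at a time. For `n = 0` the slice is a single
point, so the value at the knot matters and `hc` excludes it. -/
theorem lintegral_prod_slicePoint {n : ℕ} (e : Fin (n + 1) → ℝ) (a : Fin (n + 1) → ℕ)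
    (f : Fin (n + 1) → ℝ → ℝ≥0∞) (hf : ∀ i, Measurable (f i))
    (hfe : ∀ i t, t ≠ e i → f i t = ENNReal.ofReal (truncPow (e i) (a i) t))
    (c : ℝ) (hc : 0 < n ∨ c ≠ ∑ i, e i) :
    ∫⁻ x : Fin n → ℝ, ∏ i, f i (slicePoint c x i) =
      ENNReal.ofReal (truncPow (∑ i, e i) (∑ i, a i + n) c) := by
  induction n generalizing c with
  | zero =>
    have hc' : c ≠ e 0 := by simpa using hc
    have h0 : ∀ x : Fin 0 → ℝ, slicePoint c x 0 = c := fun x => by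
      simp [slicePoint, Fin.snoc]
    simp [h0, hfe 0 c hc', volume_pi]
  | succ n ih =>
    have hmp := (volume_preserving_piFinSuccAbove (fun _ : Fin (n + 1) => ℝ) 0).symm
    have hm : Measurable fun p : ℝ × (Fin n → ℝ) =>
        f 0 p.1 * ∏ i : Fin (n + 1), f i.succ (slicePoint (c - p.1) p.2 i) := by
      refine ((hf 0).comp measurable_fst).mul (Finset.measurable_prod _ fun i _ => ?_)
      have h1 : Measurable fun p : ℝ × (Fin n → ℝ) => slicePoint (c - p.1) p.2 :=
        measurable_slicePoint.comp ((measurable_const.sub measurable_fst).prodMk measurable_snd)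
      exact (hf _).comp ((measurable_pi_apply i).comp h1)
    rw [← hmp.lintegral_comp_emb (MeasurableEquiv.measurableEmbedding _)]
    have key : ∀ p : ℝ × (Fin n → ℝ),
        ∏ i, f i (slicePoint c
          ((MeasurableEquiv.piFinSuccAbove (fun _ : Fin (n + 1) => ℝ) 0).symm p) i) =
        f 0 p.1 * ∏ i : Fin (n + 1), f i.succ (slicePoint (c - p.1) p.2 i) := by
      rintro ⟨y, x⟩
      have : (MeasurableEquiv.piFinSuccAbove (fun _ : Fin (n + 1) => ℝ) 0).symm (y, x) =
          (Fin.cons y x : Fin (n + 1) → ℝ) := by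
        simp [MeasurableEquiv.piFinSuccAbove, Fin.insertNthEquiv]
      rw [this, slicePoint_cons, Fin.prod_univ_succ]
      simp
    simp_rw [key]
    rw [Measure.volume_eq_prod, lintegral_prod _ hm.aemeasurable]
    -- Two null values of `y` are discarded: the knot of the first factor, and the value that puts
    -- `c - y` at the total knot of the others.
    have hne : ∀ z : ℝ, ∀ᵐ y : ℝ, y ≠ z := fun z => by
      simp [ae_iff]
    rw [Fin.sum_univ_succ, Fin.sum_univ_succ a,
      show a 0 + ∑ i : Fin (n + 1), a i.succ + (n + 1) =
        a 0 + (∑ i : Fin (n + 1), a i.succ + n) + 1 by ring,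
      ← lintegral_truncPow_mul_truncPow]
    refine lintegral_congr_ae ?_
    filter_upwards [hne (e 0), hne (c - ∑ i : Fin (n + 1), e i.succ)] with y h1 h2
    rw [← ih (fun i => e i.succ) (fun i => a i.succ) (fun i => f i.succ) (fun i => hf _)
      (fun i => hfe _) (c - y) (Or.inr fun h => h2 (by linarith)), ← hfe 0 y h1,
      ← lintegral_const_mul]
    refine Finset.measurable_prod _ fun i _ => ?_
    have h1 : Measurable fun x : Fin n → ℝ => slicePoint (c - y) x :=
      measurable_slicePoint.comp (measurable_const.prodMk measurable_id)
    exact (hf _).comp ((measurable_pi_apply i).comp h1)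

/-! ### Smoothness of truncated powers -/

theorem truncPow_succ (e : ℝ) (q : ℕ) (t : ℝ) :
    truncPow e (q + 1) t = (max (t - e) 0) ^ (q + 1) / (q + 1)! := by
  unfold truncPow
  split_ifs with h
  · rw [max_eq_left (by linarith)]
  · rw [max_eq_right (by linarith)]
    simp

theorem hasDerivAt_truncPow_of_ne (e : ℝ) (q : ℕ) {t : ℝ} (ht : t ≠ e) :
    HasDerivAt (truncPow e (q + 1)) (truncPow e q t) t := by
  rcases lt_or_gt_of_ne ht with h | h
  · rw [truncPow, if_neg (by linarith)]
    refine (hasDerivAt_const t (0 : ℝ)).congr_of_eventuallyEq ?_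
    filter_upwards [Iio_mem_nhds h] with y hy
    rw [truncPow, if_neg (not_lt.2 (le_of_lt hy))]
  · rw [truncPow, if_pos h]
    refine (hasDerivAt_pow_div_factorial e q t).congr_of_eventuallyEq ?_
    filter_upwards [Ioi_mem_nhds h] with y hy
    rw [truncPow, if_pos (show e < y from hy)]

theorem hasDerivAt_truncPow (e : ℝ) (q : ℕ) (t : ℝ) :
    HasDerivAt (truncPow e (q + 2)) (truncPow e (q + 1) t) t := by
  have hcont : ∀ r, Continuous (truncPow e (r + 1)) := fun r => by
    simp_rw [funext (truncPow_succ e r)]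
    fun_prop
  rcases eq_or_ne t e with rfl | ht
  · exact hasDerivAt_of_hasDerivAt_of_ne
      (fun y hy => hasDerivAt_truncPow_of_ne t (q + 1) hy)
      (hcont (q + 1)).continuousAt (hcont q).continuousAt
  · exact hasDerivAt_truncPow_of_ne e (q + 1) ht

theorem deriv_truncPow (e : ℝ) (q : ℕ) : deriv (truncPow e (q + 2)) = truncPow e (q + 1) :=
  funext fun t => (hasDerivAt_truncPow e q t).deriv

theorem contDiff_truncPow (e : ℝ) (q : ℕ) : ContDiff ℝ q (truncPow e (q + 1)) := by
  induction q with
  | zero =>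
    simp_rw [funext (truncPow_succ e 0)]
    exact contDiff_zero.2 (by fun_prop)
  | succ q ih =>
    push_cast
    refine contDiff_succ_iff_deriv.2
      ⟨fun t => (hasDerivAt_truncPow e q t).differentiableAt, by simp, ?_⟩
    rwa [deriv_truncPow]

theorem iteratedDeriv_truncPow (e : ℝ) (q : ℕ) :
    iteratedDeriv q (truncPow e (q + 1)) = truncPow e 1 := by
  induction q with
  | zero => simp
  | succ q ih => rw [iteratedDeriv_succ', deriv_truncPow, ih]

theorem not_differentiableAt_truncPow_one (e : ℝ) : ¬ DifferentiableAt ℝ (truncPow e 1) e := by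
  intro h
  have h0 : HasDerivWithinAt (truncPow e 1) 0 (Iic e) e := by
    refine (hasDerivWithinAt_const e (Iic e) (0 : ℝ)).congr_of_mem (fun y hy => ?_) self_mem_Iic
    rw [truncPow, if_neg (not_lt.2 hy)]
  have h1 : HasDerivWithinAt (truncPow e 1) 1 (Ici e) e := by
    refine ((hasDerivWithinAt_id e (Ici e)).sub_const e).congr_of_mem (fun y hy => ?_) self_mem_Ici
    rw [truncPow_succ e 0, max_eq_left (sub_nonneg.2 hy)]
    simp
  have e0 := (uniqueDiffOn_Iic e e self_mem_Iic).eq_deriv _ h0 h.hasDerivAt.hasDerivWithinAt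
  have e1 := (uniqueDiffOn_Ici e e self_mem_Ici).eq_deriv _ h1 h.hasDerivAt.hasDerivWithinAt
  linarith

theorem contDiffAt_truncPow_of_ne {N : WithTop ℕ∞} (e : ℝ) (q : ℕ) {t : ℝ} (ht : t ≠ e) :
    ContDiffAt ℝ N (truncPow e q) t := by
  rcases lt_or_gt_of_ne ht with h | h
  · refine (contDiffAt_const (c := (0 : ℝ))).congr_of_eventuallyEq ?_
    filter_upwards [Iio_mem_nhds h] with y hy
    rw [truncPow, if_neg (not_lt.2 (le_of_lt hy))]
  · have : ContDiffAt ℝ N (fun y : ℝ => (y - e) ^ q / (q ! : ℝ)) t := by fun_prop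
    refine this.congr_of_eventuallyEq ?_
    filter_upwards [Ioi_mem_nhds h] with y hy
    rw [truncPow, if_pos (show e < y from hy)]

/-- `E` has one derivative to spare, so the kink of `a * truncPow e 1` survives in the `N`-th
derivative of the sum. -/
theorem contDiffAt_not_differentiableAt_iteratedDeriv_of_add_truncPow {N : ℕ} {e a : ℝ}
    (ha : a ≠ 0) {E : ℝ → ℝ} (hE : ContDiffAt ℝ (N + 1 : ℕ) E e) :
    ContDiffAt ℝ N (fun t => E t + a * truncPow e (N + 1) t) e ∧
      ¬ DifferentiableAt ℝ (iteratedDeriv N fun t => E t + a * truncPow e (N + 1) t) e := by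
  have hT : ContDiff ℝ N fun t => a * truncPow e (N + 1) t :=
    contDiff_const.mul (contDiff_truncPow e N)
  have hEN : ContDiffAt ℝ N E e := hE.of_le (by exact_mod_cast N.le_succ)
  refine ⟨hEN.add hT.contDiffAt, fun h => not_differentiableAt_truncPow_one e ?_⟩
  have hev : ∀ᶠ t in 𝓝 e, iteratedDeriv N (fun t => E t + a * truncPow e (N + 1) t) t =
      iteratedDeriv N E t + a * truncPow e 1 t := by
    filter_upwards [hEN.eventually (by simp)] with t ht
    rw [iteratedDeriv_fun_add ht hT.contDiffAt, iteratedDeriv_const_mul_field,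
      iteratedDeriv_truncPow]
  have hd : DifferentiableAt ℝ (iteratedDeriv N E) e := by
    rw [iteratedDeriv_eq_equiv_comp, LinearIsometryEquiv.comp_differentiableAt_iff]
    exact hE.differentiableAt_iteratedFDeriv (by exact_mod_cast N.lt_succ_self)
  have h2 := ((h.congr_of_eventuallyEq (hev.mono fun _ h => h.symm)).sub hd).const_mul a⁻¹
  refine h2.congr_of_eventuallyEq (Eventually.of_forall fun t => ?_)
  simp [ha]

/-! ### Positivity of the Laguerre moment functional -/

/-- The moment functional of `∏ e^{-wᵢ} dwᵢ` on `(0,∞)^σ`, sending `∏ wᵢ ^ mᵢ` to `∏ mᵢ!`. -/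
noncomputable def laguerreMoment {σ : Type*} [Fintype σ] (p : MvPolynomial σ ℝ) : ℝ :=
  ∑ m ∈ p.support, p.coeff m * ∏ i, ((m i)! : ℝ)

theorem integral_pow_mul_exp_neg (r : ℕ) :
    ∫ t in Ioi (0 : ℝ), t ^ r * Real.exp (-t) = r ! := by
  rw [← Real.Gamma_nat_eq_factorial, Real.Gamma_eq_integral (by positivity)]
  refine setIntegral_congr_fun measurableSet_Ioi fun t _ => ?_
  simp [mul_comm]

theorem integrable_pow_mul_exp_neg (r : ℕ) :
    Integrable (fun t : ℝ => t ^ r * Real.exp (-t)) (volume.restrict (Ioi 0)) := by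
  refine IntegrableOn.congr_fun (Real.GammaIntegral_convergent (s := r + 1) (by positivity))
    (fun t _ => ?_) measurableSet_Ioi
  simp [mul_comm]

section
variable {σ : Type*} [Fintype σ]

theorem eval_mul_exp_neg_sum (p : MvPolynomial σ ℝ) (w : σ → ℝ) :
    p.eval w * Real.exp (-∑ i, w i) =
      ∑ m ∈ p.support, p.coeff m * ∏ i, (w i ^ m i * Real.exp (-w i)) := by
  rw [MvPolynomial.eval_eq', Finset.sum_mul, ← Finset.sum_neg_distrib, Real.exp_sum]
  simp_rw [Finset.prod_mul_distrib, mul_assoc]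

theorem integrable_eval_mul_exp_neg_sum (p : MvPolynomial σ ℝ) :
    Integrable (fun w : σ → ℝ => p.eval w * Real.exp (-∑ i, w i))
      (Measure.pi fun _ => volume.restrict (Ioi (0 : ℝ))) := by
  simp_rw [eval_mul_exp_neg_sum]
  exact integrable_finsetSum _ fun m _ =>
    (Integrable.fintype_prod fun i => integrable_pow_mul_exp_neg (m i)).const_mul _

theorem integral_eval_mul_exp_neg_sum (p : MvPolynomial σ ℝ) :
    ∫ w : σ → ℝ, p.eval w * Real.exp (-∑ i, w i)
      ∂(Measure.pi fun _ => volume.restrict (Ioi (0 : ℝ))) = laguerreMoment p := by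
  simp_rw [eval_mul_exp_neg_sum]
  rw [integral_finsetSum _ fun m _ =>
    (Integrable.fintype_prod fun i => integrable_pow_mul_exp_neg (m i)).const_mul _]
  refine Finset.sum_congr rfl fun m _ => ?_
  rw [integral_const_mul, integral_fintype_prod_eq_prod (fun i t => t ^ m i * Real.exp (-t))]
  simp_rw [integral_pow_mul_exp_neg]

theorem laguerreMoment_pos {p : MvPolynomial σ ℝ} (hp : ∀ w, 0 ≤ p.eval w) {w₀ : σ → ℝ}
    (hw₀ : ∀ i, 0 < w₀ i) (hpw : p.eval w₀ ≠ 0) : 0 < laguerreMoment p := by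
  rw [← integral_eval_mul_exp_neg_sum, integral_pos_iff_support_of_nonneg
    (fun w => mul_nonneg (hp w) (Real.exp_pos _).le) (integrable_eval_mul_exp_neg_sum p),
    ← Measure.restrict_pi_pi, Measure.restrict_apply']
  · have hc : Continuous fun w : σ → ℝ => p.eval w * Real.exp (-∑ i, w i) :=
      (MvPolynomial.continuous_eval p).mul (by fun_prop)
    refine IsOpen.measure_pos _ (hc.isOpen_support.inter
      (isOpen_set_pi finite_univ fun _ _ => isOpen_Ioi)) ⟨w₀, ?_, fun i _ => hw₀ i⟩
    simpa using hpw
  · exact MeasurableSet.univ_pi fun _ => measurableSet_Ioi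

end

/-! ### The Vandermonde product near a vertex of the cube -/

/-- The indicator function of `S`. -/
def vertex {k : ℕ} (S : Finset (Fin k)) (i : Fin k) : ℝ := if i ∈ S then 1 else 0

/-- The polynomial `∏_{i < j} (tᵢ - tⱼ)²` in the coordinates `w = t - vertex S`. -/
noncomputable def shiftedVandermondeSq {k : ℕ} (S : Finset (Fin k)) : MvPolynomial (Fin k) ℝ :=
  ∏ i, ∏ j ∈ Finset.Ioi i, (MvPolynomial.X i - MvPolynomial.X j +
    MvPolynomial.C (vertex S i - vertex S j)) ^ 2

/-- The product of the factors of `shiftedVandermondeSq S` without constant term. -/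
noncomputable def leadingVandermondeSq {k : ℕ} (S : Finset (Fin k)) : MvPolynomial (Fin k) ℝ :=
  ∏ i, ∏ j ∈ Finset.Ioi i, if (i ∈ S ↔ j ∈ S) then (MvPolynomial.X i - MvPolynomial.X j) ^ 2 else 1

/-- The number of pairs `i < j` on the same side of the partition `(S, Sᶜ)`. -/
def sameSidePairs {k : ℕ} (S : Finset (Fin k)) : ℕ :=
  ∑ i, ∑ j ∈ Finset.Ioi i, if (i ∈ S ↔ j ∈ S) then 1 else 0

/-- Both sides count ordered pairs on the same side of the partition; the diagonal contributes `k`.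
-/
theorem two_mul_sameSidePairs_add {k : ℕ} (S : Finset (Fin k)) :
    2 * sameSidePairs S + k = nu S.card k := by
  set F : Fin k → Fin k → ℕ := fun i j => if (i ∈ S ↔ j ∈ S) then 1 else 0 with hF
  have hsymm : ∑ i, ∑ j ∈ Finset.Iio i, F i j = ∑ i, ∑ j ∈ Finset.Ioi i, F i j := by
    rw [Finset.sum_comm' (t' := Finset.univ) (s' := fun j => Finset.Ioi j) (by simp)]
    simp [hF, iff_comm]
  have htot : ∑ i, ∑ j, F i j = ∑ i, ∑ j ∈ Finset.Iio i, F i j +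
      ∑ i, ∑ j ∈ Finset.Ioi i, F i j + k := by
    have : ∀ i, ∑ j, F i j = ∑ j ∈ Finset.Iio i, F i j + ∑ j ∈ Finset.Ioi i, F i j + 1 := by
      intro i
      have hd : (Finset.univ : Finset (Fin k)) = insert i (Finset.Iio i ∪ Finset.Ioi i) := by
        ext j
        rcases lt_trichotomy j i with h | h | h <;> simp [h]
      rw [hd, Finset.sum_insert (by simp), Finset.sum_union]
      · simp [hF]; ring
      · exact Finset.disjoint_left.2 fun j h1 h2 => by
          simp at h1 h2; exact lt_asymm h1 h2
    simp [this, Finset.sum_add_distrib]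
  have hcard : ∑ i, ∑ j, F i j = nu S.card k := by
    have : ∀ i, ∑ j, F i j = if i ∈ S then S.card else k - S.card := by
      intro i
      by_cases hi : i ∈ S
      · simp [hF, hi]
      · have := Finset.card_compl S
        simp only [Fintype.card_fin] at this
        simp only [hF, hi, if_false, ← this, false_iff, ← Finset.card_filter]
        congr 1
        ext
        simp
    have hc := Finset.card_compl S
    simp only [Fintype.card_fin] at hc
    simp only [this]
    rw [Finset.sum_ite]
    simp [Finset.filter_not, ← Finset.compl_eq_univ_sdiff, hc, nu, sq]
  have : sameSidePairs S = ∑ i, ∑ j ∈ Finset.Ioi i, F i j := rfl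
  omega

theorem isHomogeneous_leadingVandermondeSq {k : ℕ} (S : Finset (Fin k)) :
    (leadingVandermondeSq S).IsHomogeneous (2 * sameSidePairs S) := by
  unfold leadingVandermondeSq sameSidePairs
  simp_rw [Finset.mul_sum]
  refine MvPolynomial.IsHomogeneous.prod _ _ _ fun i _ =>
    MvPolynomial.IsHomogeneous.prod _ _ _ fun j _ => ?_
  split_ifs
  · exact ((MvPolynomial.isHomogeneous_X _ _).sub (MvPolynomial.isHomogeneous_X _ _)).pow 2
  · exact MvPolynomial.isHomogeneous_one _ _

/-- A factor pairing `S` with its complement has constant term `±1`, squared to `1`. -/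
theorem exists_shiftedVandermondeSq_eq {k : ℕ} (S : Finset (Fin k)) :
    ∃ R : MvPolynomial (Fin k) ℝ, R.coeff 0 = 1 ∧
      shiftedVandermondeSq S = leadingVandermondeSq S * R := by
  refine ⟨∏ i, ∏ j ∈ Finset.Ioi i, if (i ∈ S ↔ j ∈ S) then 1 else
    (MvPolynomial.X i - MvPolynomial.X j + MvPolynomial.C (vertex S i - vertex S j)) ^ 2, ?_, ?_⟩
  · rw [← MvPolynomial.constantCoeff_eq]
    simp only [map_prod]
    refine Finset.prod_eq_one fun i _ => Finset.prod_eq_one fun j _ => ?_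
    by_cases hi : i ∈ S <;> by_cases hj : j ∈ S <;> simp [hi, hj, vertex]
  · unfold shiftedVandermondeSq leadingVandermondeSq
    simp_rw [← Finset.prod_mul_distrib]
    refine Finset.prod_congr rfl fun i _ => Finset.prod_congr rfl fun j _ => ?_
    by_cases hi : i ∈ S <;> by_cases hj : j ∈ S <;> simp [hi, hj, vertex]

theorem MvPolynomial.IsHomogeneous.coeff_mul_of_degree_le {σ R : Type*} [CommSemiring R]
    {p : MvPolynomial σ R} {d : ℕ} (hp : p.IsHomogeneous d) (q : MvPolynomial σ R) {m : σ →₀ ℕ}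
    (hm : m.degree ≤ d) : (p * q).coeff m = p.coeff m * q.coeff 0 := by
  classical
  rw [MvPolynomial.coeff_mul]
  refine Finset.sum_eq_single_of_mem (m, 0) (by simp) fun x hx hne => ?_
  by_cases h : p.coeff x.1 = 0
  · rw [h, zero_mul]
  · have h1 : x.1.degree = d := by
      rw [Finsupp.degree_eq_weight_one]; exact hp h
    rw [Finset.HasAntidiagonal.mem_antidiagonal] at hx
    have h2 : x.1.degree + x.2.degree = m.degree := by rw [← hx, map_add]
    have h3 : x.2 = 0 := by
      rw [← Finsupp.degree_eq_zero_iff]; omega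
    exact absurd (Prod.ext (by simpa [h3] using hx) h3) hne

theorem coeff_shiftedVandermondeSq {k : ℕ} (S : Finset (Fin k)) {m : Fin k →₀ ℕ}
    (hm : m.degree ≤ 2 * sameSidePairs S) :
    (shiftedVandermondeSq S).coeff m = (leadingVandermondeSq S).coeff m := by
  obtain ⟨R, hR, h⟩ := exists_shiftedVandermondeSq_eq S
  rw [h, (isHomogeneous_leadingVandermondeSq S).coeff_mul_of_degree_le R hm, hR, mul_one]

theorem le_degree_of_mem_support_shiftedVandermondeSq {k : ℕ} (S : Finset (Fin k))
    {m : Fin k →₀ ℕ} (hm : m ∈ (shiftedVandermondeSq S).support) :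
    2 * sameSidePairs S ≤ m.degree := by
  by_contra! h
  rw [MvPolynomial.mem_support_iff, coeff_shiftedVandermondeSq S h.le] at hm
  refine h.ne ?_
  rw [Finsupp.degree_eq_weight_one]
  exact isHomogeneous_leadingVandermondeSq S hm

theorem sum_coeff_shiftedVandermondeSq_pos {k : ℕ} (S : Finset (Fin k)) :
    0 < ∑ m ∈ (shiftedVandermondeSq S).support with m.degree = 2 * sameSidePairs S,
      (shiftedVandermondeSq S).coeff m * ∏ i, ((m i)! : ℝ) := by
  have hsupp : (shiftedVandermondeSq S).support.filter (fun m => m.degree = 2 * sameSidePairs S) =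
      (leadingVandermondeSq S).support := by
    ext m
    rw [Finset.mem_filter, MvPolynomial.mem_support_iff, MvPolynomial.mem_support_iff]
    constructor
    · rintro ⟨h1, h2⟩
      rwa [← coeff_shiftedVandermondeSq S h2.le]
    · intro h
      have h2 : m.degree = 2 * sameSidePairs S := by
        rw [Finsupp.degree_eq_weight_one]; exact isHomogeneous_leadingVandermondeSq S h
      exact ⟨by rwa [coeff_shiftedVandermondeSq S h2.le], h2⟩
  have heq : ∑ m ∈ (shiftedVandermondeSq S).support with m.degree = 2 * sameSidePairs S,
      (shiftedVandermondeSq S).coeff m * ∏ i, ((m i)! : ℝ) =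
        laguerreMoment (leadingVandermondeSq S) := by
    rw [laguerreMoment, ← hsupp]
    exact Finset.sum_congr rfl fun m hm => by
      rw [coeff_shiftedVandermondeSq S (Finset.mem_filter.1 hm).2.le]
  rw [heq]
  -- Any positive point with distinct coordinates would do.
  refine laguerreMoment_pos (w₀ := fun i => (i : ℝ) + 1) (fun w => ?_) (fun i => by positivity) ?_
  · simp only [leadingVandermondeSq, map_prod]
    refine Finset.prod_nonneg fun i _ => Finset.prod_nonneg fun j _ => ?_
    split_ifs
    · simp only [map_pow]; positivity
    · simp
  · simp only [leadingVandermondeSq, map_prod]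
    refine Finset.prod_ne_zero_iff.2 fun i _ => Finset.prod_ne_zero_iff.2 fun j hj => ?_
    split_ifs
    · have h1 : (i : ℝ) < j := by exact_mod_cast Finset.mem_Ioi.1 hj
      simpa using sub_ne_zero.2 h1.ne
    · simp

theorem eval_shiftedVandermondeSq {k : ℕ} (S : Finset (Fin k)) (t : Fin k → ℝ) :
    (shiftedVandermondeSq S).eval (fun i => t i - vertex S i) = vandermondeSq t := by
  simp only [shiftedVandermondeSq, vandermondeSq, map_prod, map_pow, map_add, map_sub,
    MvPolynomial.eval_X, MvPolynomial.eval_C]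
  refine Finset.prod_congr rfl fun i _ => Finset.prod_congr rfl fun j _ => ?_
  ring

/-! ### Inclusion-exclusion over the vertices -/

/-- The normalized power `(t - e)ᵐ / m!`, cut off to the half-line `t > 1` with `e = 1` if `i ∈ S`
and to `t ≥ 0` with `e = 0` otherwise. -/
noncomputable def cutPow {k : ℕ} (S : Finset (Fin k)) (i : Fin k) (m : ℕ) (t : ℝ) : ℝ :=
  if (if i ∈ S then 1 < t else 0 ≤ t) then (t - vertex S i) ^ m / m ! else 0

section
variable {k : ℕ} (S : Finset (Fin k))

theorem cutPow_nonneg (i : Fin k) (m : ℕ) (t : ℝ) : 0 ≤ cutPow S i m t := by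
  unfold cutPow vertex
  by_cases hi : i ∈ S <;> simp only [hi, if_true, if_false] <;> split_ifs with h
  · have := sub_pos.2 h
    positivity
  · exact le_rfl
  · rw [sub_zero]
    positivity
  · exact le_rfl

theorem measurable_cutPow (i : Fin k) (m : ℕ) : Measurable (cutPow S i m) := by
  unfold cutPow
  by_cases hi : i ∈ S <;> simp only [hi, if_true, if_false]
  · exact Measurable.ite measurableSet_Ioi (by fun_prop) measurable_const
  · exact Measurable.ite measurableSet_Ici (by fun_prop) measurable_const

theorem cutPow_eq_truncPow (i : Fin k) (m : ℕ) {t : ℝ} (ht : t ≠ vertex S i) :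
    cutPow S i m t = truncPow (vertex S i) m t := by
  unfold cutPow truncPow
  unfold vertex at ht ⊢
  by_cases hi : i ∈ S <;> simp only [hi, if_true, if_false] at ht ⊢
  simp only [lt_iff_le_and_ne, ht.symm, ne_eq, not_false_eq_true, and_true]

theorem sum_vertex : ∑ i, vertex S i = S.card := by
  simp [vertex]

theorem prod_cutPow (m : Fin k → ℕ) (t : Fin k → ℝ) :
    ((∏ i, ((m i)! : ℝ)) * ∏ i, cutPow S i (m i) (t i)) =
      (∏ i, if (if i ∈ S then 1 < t i else 0 ≤ t i) then 1 else 0) *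
        ∏ i, (t i - vertex S i) ^ m i := by
  simp_rw [← Finset.prod_mul_distrib]
  refine Finset.prod_congr rfl fun i _ => ?_
  have : ((m i)! : ℝ) ≠ 0 := by positivity
  unfold cutPow
  by_cases h : if i ∈ S then 1 < t i else 0 ≤ t i <;> simp only [h, if_true, if_false]
  · field_simp
  · simp

end

/-- Expansion of `∏ (1_{tᵢ ≥ 0} - 1_{tᵢ > 1})`. Mixing strict and weak cut-offs makes it exact on
the boundary too. -/
theorem sum_neg_one_pow_card_mul_prod_ite {k : ℕ} (t : Fin k → ℝ) :
    ∑ S : Finset (Fin k), (-1 : ℝ) ^ S.card *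
        ∏ i, (if (if i ∈ S then 1 < t i else 0 ≤ t i) then 1 else 0) =
      if ∀ i, t i ∈ Icc (0 : ℝ) 1 then 1 else 0 := by
  have hprod : (∏ i, (-(if 1 < t i then 1 else 0) + if 0 ≤ t i then 1 else 0 : ℝ)) =
      if ∀ i, t i ∈ Icc (0 : ℝ) 1 then 1 else 0 := by
    have hfac : ∀ i, (-(if 1 < t i then 1 else 0) + if 0 ≤ t i then 1 else 0 : ℝ) =
        if t i ∈ Icc (0 : ℝ) 1 then 1 else 0 := by
      intro i
      by_cases h1 : 1 < t i
      · simp [h1, zero_le_one.trans h1.le, h1.not_ge]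
      · simp [h1, not_lt.1 h1]
    simp_rw [hfac]
    by_cases h : ∀ i, t i ∈ Icc (0 : ℝ) 1
    · rw [if_pos h]
      exact Finset.prod_eq_one fun i _ => if_pos (h i)
    · rw [if_neg h]
      obtain ⟨i, hi⟩ := not_forall.1 h
      exact Finset.prod_eq_zero (Finset.mem_univ i) (if_neg hi)
  rw [← hprod, Fintype.prod_add]
  refine Finset.sum_congr rfl fun S _ => ?_
  rw [Finset.prod_neg, mul_assoc, ← Finset.prod_mul_prod_compl S]
  congr 2
  · exact Finset.prod_congr rfl fun i hi => by simp [hi]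
  · exact Finset.prod_congr rfl fun i hi => by simp [Finset.mem_compl.1 hi]

/-- The coefficient with which the exponent vector `m` contributes to the slice integral. -/
noncomputable def sliceCoeff {k : ℕ} (S : Finset (Fin k)) (m : Fin k →₀ ℕ) : ℝ :=
  (shiftedVandermondeSq S).coeff m * ∏ i, ((m i)! : ℝ)

theorem indicator_vandermondeSq {k : ℕ} (t : Fin k → ℝ) :
    (if ∀ i, t i ∈ Icc (0 : ℝ) 1 then vandermondeSq t else 0) =
      ∑ S : Finset (Fin k), ∑ m ∈ (shiftedVandermondeSq S).support,
        (-1 : ℝ) ^ S.card * sliceCoeff S m * ∏ i, cutPow S i (m i) (t i) := by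
  have h : ∀ S : Finset (Fin k), ∑ m ∈ (shiftedVandermondeSq S).support,
      (-1 : ℝ) ^ S.card * sliceCoeff S m * ∏ i, cutPow S i (m i) (t i) =
      (-1 : ℝ) ^ S.card * (∏ i, (if (if i ∈ S then 1 < t i else 0 ≤ t i) then 1 else 0)) *
        vandermondeSq t := by
    intro S
    rw [← eval_shiftedVandermondeSq S, MvPolynomial.eval_eq', Finset.mul_sum]
    refine Finset.sum_congr rfl fun m _ => ?_
    have := prod_cutPow S m t
    unfold sliceCoeff
    linear_combination ((-1 : ℝ) ^ S.card * (shiftedVandermondeSq S).coeff m) * this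
  simp_rw [h]
  rw [← Finset.sum_mul, sum_neg_one_pow_card_mul_prod_ite]
  split_ifs <;> simp

theorem lintegral_prod_cutPow {n : ℕ} (hn : 0 < n) (S : Finset (Fin (n + 1)))
    (m : Fin (n + 1) →₀ ℕ) (c : ℝ) :
    ∫⁻ x : Fin n → ℝ, ENNReal.ofReal (∏ i, cutPow S i (m i) (slicePoint c x i)) =
      ENNReal.ofReal (truncPow S.card (m.degree + n) c) := by
  simp_rw [ENNReal.ofReal_prod_of_nonneg fun i _ => cutPow_nonneg S i (m i) _]
  rw [lintegral_prod_slicePoint (vertex S) m (fun i t => ENNReal.ofReal (cutPow S i (m i) t))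
    (fun i => (measurable_cutPow S i (m i)).ennreal_ofReal)
    (fun i t ht => by rw [cutPow_eq_truncPow S i (m i) ht]) c (Or.inl hn), sum_vertex,
    Finsupp.degree_eq_sum]

theorem measurable_prod_cutPow {n : ℕ} (S : Finset (Fin (n + 1))) (m : Fin (n + 1) →₀ ℕ) (c : ℝ) :
    Measurable fun x : Fin n → ℝ => ∏ i, cutPow S i (m i) (slicePoint c x i) := by
  refine Finset.measurable_prod _ fun i _ => ?_
  have h : Measurable fun x : Fin n → ℝ => slicePoint c x :=
    measurable_slicePoint.comp (measurable_const.prodMk measurable_id)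
  exact (measurable_cutPow S i (m i)).comp ((measurable_pi_apply i).comp h)

theorem integrable_prod_cutPow {n : ℕ} (hn : 0 < n) (S : Finset (Fin (n + 1)))
    (m : Fin (n + 1) →₀ ℕ) (c : ℝ) :
    Integrable fun x : Fin n → ℝ => ∏ i, cutPow S i (m i) (slicePoint c x i) := by
  refine ⟨(measurable_prod_cutPow S m c).aestronglyMeasurable, ?_⟩
  rw [hasFiniteIntegral_iff_ofReal (Eventually.of_forall fun x =>
    Finset.prod_nonneg fun i _ => cutPow_nonneg S i (m i) _), lintegral_prod_cutPow hn]
  exact ENNReal.ofReal_lt_top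

theorem integral_prod_cutPow {n : ℕ} (hn : 0 < n) (S : Finset (Fin (n + 1)))
    (m : Fin (n + 1) →₀ ℕ) (c : ℝ) :
    ∫ x : Fin n → ℝ, ∏ i, cutPow S i (m i) (slicePoint c x i) =
      truncPow S.card (m.degree + n) c := by
  rw [integral_eq_lintegral_of_nonneg_ae (Eventually.of_forall fun x =>
    Finset.prod_nonneg fun i _ => cutPow_nonneg S i (m i) _)
    (measurable_prod_cutPow S m c).aestronglyMeasurable, lintegral_prod_cutPow hn,
    ENNReal.toReal_ofReal (truncPow_nonneg _ _ _)]

/-! ### The spline formula and its singularity at `c = j` -/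

/-- The normalizing constant of `gammaFun (n + 1)`. -/
noncomputable def gammaConst (n : ℕ) : ℝ :=
  1 / (((n + 1)! : ℝ) * (Nat.superFactorial n : ℝ) ^ 2)

theorem gammaConst_pos (n : ℕ) : 0 < gammaConst n := by
  have : 0 < Nat.superFactorial n := by
    induction n with
    | zero => simp
    | succ n ih => rw [Nat.superFactorial_succ]; positivity
  unfold gammaConst
  positivity

theorem gammaFun_eq_sum_truncPow {n : ℕ} (hn : 0 < n) (c : ℝ) :
    gammaFun (n + 1) c = ∑ S : Finset (Fin (n + 1)), ∑ m ∈ (shiftedVandermondeSq S).support,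
      gammaConst n * ((-1 : ℝ) ^ S.card * sliceCoeff S m) * truncPow S.card (m.degree + n) c := by
  have hmeas : MeasurableSet {x : Fin n → ℝ | ∀ i, slicePoint c x i ∈ Icc (0 : ℝ) 1} := by
    have h : Measurable fun x : Fin n → ℝ => slicePoint c x :=
      measurable_slicePoint.comp (measurable_const.prodMk measurable_id)
    rw [ofPred_forall]
    exact MeasurableSet.iInter fun i => ((measurable_pi_apply i).comp h) measurableSet_Icc
  have hint : ∫ x in {x : Fin n → ℝ | ∀ i, slicePoint c x i ∈ Icc (0 : ℝ) 1},
      vandermondeSq (slicePoint c x) = ∑ S : Finset (Fin (n + 1)),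
        ∑ m ∈ (shiftedVandermondeSq S).support,
          (-1 : ℝ) ^ S.card * sliceCoeff S m * truncPow S.card (m.degree + n) c := by
    rw [← integral_indicator hmeas]
    have hfun : ({x : Fin n → ℝ | ∀ i, slicePoint c x i ∈ Icc (0 : ℝ) 1}.indicator
        fun x => vandermondeSq (slicePoint c x)) = fun x => ∑ S : Finset (Fin (n + 1)),
          ∑ m ∈ (shiftedVandermondeSq S).support,
            (-1 : ℝ) ^ S.card * sliceCoeff S m * ∏ i, cutPow S i (m i) (slicePoint c x i) := by
      classical
      funext x
      rw [← indicator_vandermondeSq, indicator_apply]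
      rfl
    rw [hfun, integral_finsetSum _ fun S _ => integrable_finsetSum _ fun m _ =>
      (integrable_prod_cutPow hn S m c).const_mul _]
    refine Finset.sum_congr rfl fun S _ => ?_
    rw [integral_finsetSum _ fun m _ => (integrable_prod_cutPow hn S m c).const_mul _]
    refine Finset.sum_congr rfl fun m _ => ?_
    rw [integral_const_mul, integral_prod_cutPow hn]
  rw [gammaFun, hint, ← gammaConst]
  simp_rw [Finset.mul_sum, mul_assoc]

theorem exists_gammaFun_eq_add_truncPow {j n N : ℕ} (hn : 0 < n) (hj : j ≤ n + 1)
    (hN : nu j (n + 1) = N + 2) :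
    ∃ (a : ℝ) (E : ℝ → ℝ), a ≠ 0 ∧ ContDiffAt ℝ (N + 1 : ℕ) E j ∧
      gammaFun (n + 1) = fun t => E t + a * truncPow j (N + 1) t := by
  classical
  set F : Finset (Fin (n + 1)) → (Fin (n + 1) →₀ ℕ) → ℝ → ℝ := fun S m t =>
    gammaConst n * ((-1 : ℝ) ^ S.card * sliceCoeff S m) * truncPow S.card (m.degree + n) t with hF
  set lead : Finset (Fin (n + 1)) → (Fin (n + 1) →₀ ℕ) → Prop := fun S m =>
    S.card = j ∧ m.degree = 2 * sameSidePairs S with hlead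
  -- The leading exponent: `(ν - k) + (k - 1) = ν - 1`.
  have hdeg : ∀ S : Finset (Fin (n + 1)), S.card = j → 2 * sameSidePairs S + n = N + 1 := by
    intro S hS
    have := two_mul_sameSidePairs_add S
    rw [hS, hN] at this
    omega
  refine ⟨∑ S : Finset (Fin (n + 1)) with S.card = j,
    ∑ m ∈ (shiftedVandermondeSq S).support with m.degree = 2 * sameSidePairs S,
      gammaConst n * ((-1 : ℝ) ^ j * sliceCoeff S m),
    fun t => ∑ S : Finset (Fin (n + 1)), ∑ m ∈ (shiftedVandermondeSq S).support,
      if lead S m then 0 else F S m t, ?_, ?_, ?_⟩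
  · simp_rw [← Finset.mul_sum]
    refine mul_ne_zero (gammaConst_pos n).ne' (mul_ne_zero (by simp) (ne_of_gt ?_))
    refine Finset.sum_pos (fun S _ => sum_coeff_shiftedVandermondeSq_pos S) ?_
    obtain ⟨S, -, hS⟩ := Finset.exists_subset_card_eq
      (show j ≤ (Finset.univ : Finset (Fin (n + 1))).card by simpa using hj)
    exact ⟨S, by simpa using hS⟩
  · refine ContDiffAt.sum fun S _ => ContDiffAt.sum fun m hm => ?_
    by_cases h : lead S m
    · simp only [h, if_true]
      exact contDiffAt_const
    · simp only [h, if_false, hF]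
      refine contDiffAt_const.mul ?_
      by_cases hS : S.card = j
      · have h1 := le_degree_of_mem_support_shiftedVandermondeSq S hm
        have h2 : m.degree ≠ 2 * sameSidePairs S := fun h' => h ⟨hS, h'⟩
        have h3 := hdeg S hS
        obtain ⟨r, hr⟩ : ∃ r, m.degree + n = r + 1 := ⟨m.degree + n - 1, by omega⟩
        rw [hr]
        refine ((contDiff_truncPow _ r).of_le ?_).contDiffAt
        exact_mod_cast (show N + 1 ≤ r by omega)
      · exact contDiffAt_truncPow_of_ne _ _ (by exact_mod_cast Ne.symm hS)
  · funext t
    rw [gammaFun_eq_sum_truncPow hn, Finset.sum_filter, Finset.sum_mul, ← Finset.sum_add_distrib]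
    refine Finset.sum_congr rfl fun S _ => ?_
    by_cases hS : S.card = j
    · rw [if_pos hS, Finset.sum_filter, Finset.sum_mul, ← Finset.sum_add_distrib]
      refine Finset.sum_congr rfl fun m _ => ?_
      by_cases hm : m.degree = 2 * sameSidePairs S
      · simp [hlead, hS, hm, hdeg S hS]
      · simp [hlead, hS, hm, hF]
    · rw [if_neg hS]
      simp [hlead, hS, hF]

theorem mainTheorem2 (j k : ℕ) (hj : 0 < j) (hjk : j < k) :
    ContDiffAt ℝ ((nu j k - 2 : ℕ) : WithTop ℕ∞) (gammaFun k) (j : ℝ) ∧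
      ¬ DifferentiableAt ℝ (iteratedDeriv (nu j k - 2) (gammaFun k)) (j : ℝ) := by
  obtain ⟨n, rfl⟩ : ∃ n, k = n + 1 := ⟨k - 1, by omega⟩
  obtain ⟨N, hN⟩ : ∃ N, nu j (n + 1) = N + 2 := by
    refine Nat.exists_eq_add_of_le' ?_
    have h1 : 1 ≤ j ^ 2 := Nat.one_le_pow _ _ hj
    have h2 : 1 ≤ (n + 1 - j) ^ 2 := Nat.one_le_pow _ _ (by omega)
    unfold nu
    omega
  obtain ⟨a, E, ha, hE, h⟩ := exists_gammaFun_eq_add_truncPow (by omega) hjk.le hN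
  rw [hN, Nat.add_sub_cancel, h]
  exact contDiffAt_not_differentiableAt_iteratedDeriv_of_add_truncPow ha hE
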